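/- Let $(M,\omega)$ be a finite-dimensional symplectic manifold and $(\Sigma,j)$ a compact Riemann surface, oriented by $j$. Let $\mathcal S_{\mathrm i}(\Sigma)$ be the set of smooth immersions $f\colon\Sigma\to M$ for which $f^*\omega$ is a symplectic form on $\Sigma$, and identify $T_f\mathcal S_{\mathrm i}(\Sigma)$ with the space of smooth sections $\tau$ of $f^*TM$. Define a two-form on $\mathcal S_{\mathrm i}(\Sigma)$ by $$(\omega_{\mathcal S_{\mathrm i}(\Sigma)})_f(\tau_1,\tau_2)=\int_{\{f\}\times\Sigma}\iota_{\ell_1\wedge\ell_2}\,\mathrm{ev}^*(\omega\wedge\omega),$$ where $\mathrm{ev}(f,x)=f(x)$, with differential $d\,\mathrm{ev}_{(f,x)}(\nu,v)=\nu(x)+df_x(v)$, and $\ell_i$ is any lifting of $\tau_i$ to a field of tangent vectors of $C^\infty(\Sigma,M)\times\Sigma$ along $\{f\}\times\Sigma$ (the value does not depend on the liftings); that is, the integrand at $x$ is the two-form $(z_1,z_2)\mapsto(\omega\wedge\omega)_{f(x)}(\tau_1(x),\tau_2(x),df_x z_1,df_x z_2)$. A section $\tau$ is everywhere tangent to $f(\Sigma)$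 if $\tau(x)\in df_x(T_x\Sigma)$ for every $x\in\Sigma$. Let $J$ be a smooth almost complex structure on $M$, put $(\tilde J\tau)(x)=J_{f(x)}\tau(x)$, and let $f\in\mathcal S_{\mathrm i}(\Sigma)$ be $J$-holomorphic, i.e. $df_x\circ j_x=J_{f(x)}\circ df_x$ for all $x$. (1) If $J$ is $\omega$-tamed, i.e. $\omega_x(v,Jv)>0$ for all $x\in M$ and $0\ne v\in T_xM$, then $$(\omega_{\mathcal S_{\mathrm i}(\Sigma)})_f(\tau,\tilde J\tau)>0$$ for every $\tau\in T_f\mathcal S_{\mathrm i}(\Sigma)$ that is not everywhere tangent to $f(\Sigma)$. (2) If $J$ is $\omega$-compatible, i.e. $\omega$-tamed with $\omega(Jv,Jw)=\omega(v,w)$ for all $v,w$, then $\tilde J$ is compatible with $\omega_{\mathcal S_{\mathrm i}(\Sigma)}$ at $f$, up to reparametrizations: $\tilde J^2=-\mathrm{Id}$ on $T_f\mathcal S_{\mathrm i}(\Sigma)$; $\tilde J$ maps everywhere tangent sections to everywhere tangent sections; $(\omega_{\mathcal S_{\mathrm i}(\Sigma)})_f(\tilde J\tau_1,\tilde J\tau_2)=(\omega_{\mathcal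 S_{\mathrm i}(\Sigma)})_f(\tau_1,\tau_2)$ for all $\tau_1,\tau_2$; and $(\omega_{\mathcal S_{\mathrm i}(\Sigma)})_f(\tau,\tilde J\tau)>0$ for every $\tau$ that is not everywhere tangent to $f(\Sigma)$. -/

import Mathlib

open Set Bundle MeasureTheory
open scoped Manifold ContDiff

noncomputable section

namespace SymplecticCurves

/-! ### Differential two-forms and almost complex structures on a real manifold -/

section Manifolds

variable (E : Type*) [NormedAddCommGroup E] [NormedSpace ℝ E]
  (M : Type*) [TopologicalSpace M] [ChartedSpace E M]

/-- A (not necessarily smooth or alternating) field of bilinear forms on the tangent spaces of the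
manifold `M` modelled on `E`. -/
abbrev BilinearField : Type _ :=
  ∀ x : M, TangentSpace 𝓘(ℝ, E) x →L[ℝ] TangentSpace 𝓘(ℝ, E) x →L[ℝ] ℝ

variable {E M}

/-- The expression `(φ⁻¹)^* Ω` of `Ω` in the chart `φ` at `c`, a field of bilinear forms on the open
subset `φ.target` of `E`. -/
def BilinearField.inChart (Ω : BilinearField E M) (c : M) (y v w : E) : ℝ :=
  Ω ((chartAt E c).symm y)
    (mfderiv 𝓘(ℝ, E) 𝓘(ℝ, E) (chartAt E c).symm y v)
    (mfderiv 𝓘(ℝ, E) 𝓘(ℝ, E) (chartAt E c).symm y w)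

/-- `Ω` is a symplectic form: a smooth, closed, nondegenerate differential two-form.
Closedness is the vanishing, in the charts, of
`dΩ(u, v, w) = ∂_u Ω(v, w) + ∂_v Ω(w, u) + ∂_w Ω(u, v)`, with `u, v, w` constant vectors. -/
structure IsSymplecticForm [IsManifold 𝓘(ℝ, E) ∞ M] (Ω : BilinearField E M) : Prop where
  smooth : ContMDiff 𝓘(ℝ, E) (𝓘(ℝ, E).prod 𝓘(ℝ, E →L[ℝ] E →L[ℝ] ℝ)) ∞
    (fun x : M ↦ (TotalSpace.mk' (E →L[ℝ] E →L[ℝ] ℝ) x (Ω x) :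
      TotalSpace (E →L[ℝ] E →L[ℝ] ℝ)
        (fun x : M ↦ TangentSpace 𝓘(ℝ, E) x →L[ℝ] TangentSpace 𝓘(ℝ, E) x →L[ℝ] ℝ)))
  alternating : ∀ (x : M) (v : TangentSpace 𝓘(ℝ, E) x), Ω x v v = 0
  nondegenerate : ∀ (x : M) (v : TangentSpace 𝓘(ℝ, E) x),
    (∀ w : TangentSpace 𝓘(ℝ, E) x, Ω x v w = 0) → v = 0
  closed : ∀ c : M, ∀ y ∈ (chartAt E c).target, ∀ u v w : E,
    fderiv ℝ (fun y' ↦ Ω.inChart c y' v w) y u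
      + fderiv ℝ (fun y' ↦ Ω.inChart c y' w u) y v
      + fderiv ℝ (fun y' ↦ Ω.inChart c y' u v) y w = 0

variable (E M) in
/-- A (smooth) almost complex structure: a smooth endomorphism of the tangent bundle with
square `-1`. -/
structure AlmostComplexStructure [IsManifold 𝓘(ℝ, E) ∞ M] where
  toFun : ∀ x : M, TangentSpace 𝓘(ℝ, E) x →L[ℝ] TangentSpace 𝓘(ℝ, E) x
  smooth : ContMDiff 𝓘(ℝ, E) (𝓘(ℝ, E).prod 𝓘(ℝ, E →L[ℝ] E)) ∞
    (fun x : M ↦ (TotalSpace.mk' (E →L[ℝ] E) x (toFun x) :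
      TotalSpace (E →L[ℝ] E)
        (fun x : M ↦ TangentSpace 𝓘(ℝ, E) x →L[ℝ] TangentSpace 𝓘(ℝ, E) x)))
  sq : ∀ (x : M) (v : TangentSpace 𝓘(ℝ, E) x), toFun x (toFun x v) = -v

variable [IsManifold 𝓘(ℝ, E) ∞ M]

/-- `J` is `Ω`-tamed. -/
def AlmostComplexStructure.IsTamed (J : AlmostComplexStructure E M) (Ω : BilinearField E M) :
    Prop :=
  ∀ (x : M) (v : TangentSpace 𝓘(ℝ, E) x), v ≠ 0 → 0 < Ω x v (J.toFun x v)

/-- `J` is `Ω`-compatible: it is `Ω`-tamed and preserves `Ω`. -/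
def AlmostComplexStructure.IsCompatible (J : AlmostComplexStructure E M)
    (Ω : BilinearField E M) : Prop :=
  J.IsTamed Ω ∧
    ∀ (x : M) (v w : TangentSpace 𝓘(ℝ, E) x), Ω x (J.toFun x v) (J.toFun x w) = Ω x v w

end Manifolds

/-! ### Riemann surfaces and integration of two-forms over them -/

section Surfaces

variable {S : Type*} [TopologicalSpace S] [ChartedSpace ℂ S]

/-- The smooth real surface underlying a Riemann surface. -/
instance instIsManifoldReal [IsManifold 𝓘(ℂ) ω S] : IsManifold 𝓘(ℝ, ℂ) ∞ S := by
  refine isManifold_of_contDiffOn 𝓘(ℝ, ℂ) ∞ S fun e e' he he' ↦ ?_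
  have h := (contDiffGroupoid ω 𝓘(ℂ)).compatible he he'
  rw [contDiffGroupoid, mem_groupoid_of_pregroupoid] at h
  have h1 : ContDiffOn ℂ ω (𝓘(ℂ) ∘ (e.symm ≫ₕ e') ∘ 𝓘(ℂ).symm)
    (𝓘(ℂ).symm ⁻¹' (e.symm ≫ₕ e').source ∩ range 𝓘(ℂ)) := h.1
  exact (h1.restrict_scalars ℝ).of_le le_top

/-- The complex structure `j` of a Riemann surface, multiplication by `i` on its tangent spaces
(the tangent space at `x` is identified with `ℂ` by the preferred holomorphic chart at `x`). -/
def complexStructure (x : S) : TangentSpace 𝓘(ℝ, ℂ) x →L[ℝ] TangentSpace 𝓘(ℝ, ℂ) x :=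
  (Complex.I • ContinuousLinearMap.id ℝ ℂ : ℂ →L[ℝ] ℂ)

/-- The coefficient `η(∂_s, ∂_t)` of a field `η` of two-forms at the point of the surface with
coordinate `z = s + i t` in the holomorphic chart at `c`. -/
def chartCoeff (η : ∀ x : S, TangentSpace 𝓘(ℝ, ℂ) x → TangentSpace 𝓘(ℝ, ℂ) x → ℝ)
    (c : S) (z : ℂ) : ℝ :=
  η ((chartAt ℂ c).symm z)
    (mfderiv 𝓘(ℝ, ℂ) 𝓘(ℝ, ℂ) (chartAt ℂ c).symm z (1 : ℂ))
    (mfderiv 𝓘(ℝ, ℂ) 𝓘(ℝ, ℂ) (chartAt ℂ c).symm z Complex.I)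

variable (S) in
/-- A smooth partition of unity on the surface, subordinate to the cover by the domains of the
preferred holomorphic charts. -/
def chartPartition [IsManifold 𝓘(ℂ) ω S] [T2Space S] [CompactSpace S] :
    SmoothPartitionOfUnity S 𝓘(ℝ, ℂ) S univ :=
  Classical.choose (SmoothPartitionOfUnity.exists_isSubordinate_chartAt_source 𝓘(ℝ, ℂ) S)

theorem chartPartition_isSubordinate [IsManifold 𝓘(ℂ) ω S] [T2Space S] [CompactSpace S] :
    (chartPartition S).IsSubordinate (fun x ↦ (chartAt ℂ x).source) :=
  Classical.choose_spec
    (SmoothPartitionOfUnity.exists_isSubordinate_chartAt_source 𝓘(ℝ, ℂ) S)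

/-- The integral `∫_S η` of a two-form over a compact Riemann surface with its complex orientation,
by a partition of unity subordinate to the holomorphic charts. -/
def surfaceIntegral [IsManifold 𝓘(ℂ) ω S] [T2Space S] [CompactSpace S]
    (η : ∀ x : S, TangentSpace 𝓘(ℝ, ℂ) x → TangentSpace 𝓘(ℝ, ℂ) x → ℝ) : ℝ :=
  ∑ᶠ c : S, ∫ z in (chartAt ℂ c).target,
    chartPartition S c ((chartAt ℂ c).symm z) * chartCoeff η c z

end Surfaces

/-! ### The exterior product of two two-forms -/

/-- The exterior product `α ∧ β` of two alternating bilinear forms, as the signed sum over the six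
`(2, 2)`-shuffles. In particular `(α ∧ α)(a, b, c, d)` is
`2 (α(a, b) α(c, d) - α(a, c) α(b, d) + α(a, d) α(b, c))`. -/
def wedge {V : Type*} (α β : V → V → ℝ) (a b c d : V) : ℝ :=
  α a b * β c d - α a c * β b d + α a d * β b c
    + α b c * β a d - α b d * β a c + α c d * β a b

/-- If `Ω` is alternating then `Ω ∧ Ω`, evaluated at two vectors of a subspace of dimension at most two,
depends only on the other two vectors modulo that subspace. -/
theorem wedge_add_map {V : Type*} [AddCommGroup V] [Module ℝ V] (B : V →ₗ[ℝ] V →ₗ[ℝ] ℝ)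
    (hB : ∀ v, B v v = 0) (P : ℂ →ₗ[ℝ] V) (a b : V) (v w z₁ z₂ : ℂ) :
    wedge (fun v w ↦ B v w) (fun v w ↦ B v w) (a + P v) (b + P w) (P z₁) (P z₂)
      = wedge (fun v w ↦ B v w) (fun v w ↦ B v w) a b (P z₁) (P z₂) := by
  have hs : ∀ x y, B x y = -B y x := by
    intro x y
    have h := hB (x + y)
    simp only [map_add, LinearMap.add_apply, hB] at h
    linarith
  have hP : ∀ z : ℂ, P z = z.re • P 1 + z.im • P Complex.I := by
    intro z
    rw [← map_smul, ← map_smul, ← map_add]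
    congr 1
    apply Complex.ext <;> simp
  rw [hP v, hP w, hP z₁, hP z₂]
  simp only [wedge, map_add, map_smul, LinearMap.add_apply, LinearMap.smul_apply, smul_eq_mul, hB]
  rw [hs (P 1) b, hs (P Complex.I) b, hs (P Complex.I) (P 1)]
  ring

/-! ### The space of smooth maps from a Riemann surface to a manifold -/

section MappingSpace

variable {E : Type*} [NormedAddCommGroup E] [NormedSpace ℝ E]
  {M : Type*} [TopologicalSpace M] [ChartedSpace E M]
  {S : Type*} [TopologicalSpace S] [ChartedSpace ℂ S]

/-- The pull-back `f^* Ω`. -/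
def pullbackForm (Ω : BilinearField E M) (f : C^∞⟮𝓘(ℝ, ℂ), S; 𝓘(ℝ, E), M⟯) :
    BilinearField ℂ S := fun x ↦
  ContinuousLinearMap.bilinearComp (E := E) (F := E) (E' := ℂ) (F' := ℂ) (Ω (f x))
    (mfderiv 𝓘(ℝ, ℂ) 𝓘(ℝ, E) f x) (mfderiv 𝓘(ℝ, ℂ) 𝓘(ℝ, E) f x)

variable [IsManifold 𝓘(ℝ, E) ∞ M]

/-- The space `S_i(Σ)` of immersed symplectic surfaces: smooth maps `f : S → M` which are
immersions and for which `f^* Ω` is a symplectic form on `S`. -/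
def immersedSymplectic [IsManifold 𝓘(ℂ) ω S] (Ω : BilinearField E M) :
    Set C^∞⟮𝓘(ℝ, ℂ), S; 𝓘(ℝ, E), M⟯ :=
  {f | (∀ x : S, Function.Injective (mfderiv 𝓘(ℝ, ℂ) 𝓘(ℝ, E) f x)) ∧
    IsSymplecticForm (pullbackForm Ω f)}

/-- `f` is `J`-holomorphic: `df ∘ j = J ∘ df`. -/
def IsJHolomorphic (J : AlmostComplexStructure E M)
    (f : C^∞⟮𝓘(ℝ, ℂ), S; 𝓘(ℝ, E), M⟯) : Prop :=
  ∀ (x : S) (v : TangentSpace 𝓘(ℝ, ℂ) x),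
    mfderiv 𝓘(ℝ, ℂ) 𝓘(ℝ, E) f x (complexStructure x v)
      = J.toFun (f x) (mfderiv 𝓘(ℝ, ℂ) 𝓘(ℝ, E) f x v)

instance instAddCommGroupPullback (f : C^∞⟮𝓘(ℝ, ℂ), S; 𝓘(ℝ, E), M⟯) (x : S) :
    AddCommGroup ((f *ᵖ (TangentSpace 𝓘(ℝ, E) : M → Type _)) x) :=
  inferInstanceAs (AddCommGroup (TangentSpace 𝓘(ℝ, E) (f x)))

/-- The tangent space at `f` of the space of smooth maps: the smooth sections of `f^* TM`. -/
abbrev MapTangent (f : C^∞⟮𝓘(ℝ, ℂ), S; 𝓘(ℝ, E), M⟯) : Type _ :=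
  Cₛ^∞⟮𝓘(ℝ, ℂ); E, (f *ᵖ (TangentSpace 𝓘(ℝ, E) : M → Type _))⟯

/-- The value at `x`, in `T_{f(x)} M`, of a vector field along `f`. -/
def MapTangent.val {f : C^∞⟮𝓘(ℝ, ℂ), S; 𝓘(ℝ, E), M⟯} (τ : MapTangent f) (x : S) :
    TangentSpace 𝓘(ℝ, E) (f x) := τ x

/-- A vector field along `f` is tangent to `f(S)` at every point. -/
def EverywhereTangent {f : C^∞⟮𝓘(ℝ, ℂ), S; 𝓘(ℝ, E), M⟯} (τ : MapTangent f) : Prop :=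
  ∀ x : S, τ.val x ∈ range (mfderiv 𝓘(ℝ, ℂ) 𝓘(ℝ, E) f x)

/-- A section of `f^* TM` is smooth exactly if it is smooth as a map to `TM`. -/
theorem contMDiff_along_iff (f : C^∞⟮𝓘(ℝ, ℂ), S; 𝓘(ℝ, E), M⟯)
    (s : ∀ x : S, TangentSpace 𝓘(ℝ, E) (f x)) :
    ContMDiff 𝓘(ℝ, ℂ) (𝓘(ℝ, ℂ).prod 𝓘(ℝ, E)) ∞
      (fun x ↦ (TotalSpace.mk' E x (s x) :
        TotalSpace E (f *ᵖ (TangentSpace 𝓘(ℝ, E) : M → Type _)))) ↔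
    ContMDiff 𝓘(ℝ, ℂ) (𝓘(ℝ, E).prod 𝓘(ℝ, E)) ∞
      (fun x ↦ (TotalSpace.mk' E (f x) (s x) : TangentBundle 𝓘(ℝ, E) M)) := by
  refine forall_congr' fun x₀ ↦ ?_
  rw [contMDiffAt_totalSpace, contMDiffAt_totalSpace]
  refine and_congr ?_ Iff.rfl
  exact iff_of_true contMDiffAt_id f.contMDiff.contMDiffAt

/-- The induced almost complex structure `J̃` on the space of maps: `(J̃ τ)(x) = J_{f(x)} τ(x)`. -/
def inducedJ (J : AlmostComplexStructure E M) (f : C^∞⟮𝓘(ℝ, ℂ), S; 𝓘(ℝ, E), M⟯)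
    (τ : MapTangent f) : MapTangent f where
  toFun x := J.toFun (f x) (τ.val x)
  contMDiff_toFun := by
    have h := (contMDiff_along_iff f τ.val).1 τ.contMDiff
    refine (contMDiff_along_iff f (fun x ↦ J.toFun (f x) (τ.val x))).2 ?_
    intro x
    exact ContMDiffAt.clm_bundle_apply (b := f)
      (ϕ := fun x ↦ J.toFun (f x)) (v := fun x ↦ τ.val x)
      ((J.smooth (f x)).comp x f.contMDiff.contMDiffAt) (h x)

/-- The differential of the evaluation map `ev(f, x) = f(x)` at `(f, x)`:
`(ν, v) ↦ ν(x) + df_x(v)`. -/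
def evDifferential (f : C^∞⟮𝓘(ℝ, ℂ), S; 𝓘(ℝ, E), M⟯) (x : S)
    (ξ : MapTangent f × TangentSpace 𝓘(ℝ, ℂ) x) : TangentSpace 𝓘(ℝ, E) (f x) :=
  ξ.1.val x + mfderiv 𝓘(ℝ, ℂ) 𝓘(ℝ, E) f x ξ.2

/-- `ℓ`, a field of tangent vectors of (maps) × (surface) along `{f} × S`, is a lifting of `τ`. -/
def IsLifting {f : C^∞⟮𝓘(ℝ, ℂ), S; 𝓘(ℝ, E), M⟯} (τ : MapTangent f)
    (l : ∀ x : S, MapTangent f × TangentSpace 𝓘(ℝ, ℂ) x) : Prop :=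
  ∀ x : S, (l x).1 = τ

/-- The restriction of `ι_{ℓ₁ ∧ ℓ₂} ev^*(Ω ∧ Ω)` to `{f} × S`. -/
def fiberForm (Ω : BilinearField E M) (f : C^∞⟮𝓘(ℝ, ℂ), S; 𝓘(ℝ, E), M⟯)
    (l₁ l₂ : ∀ x : S, MapTangent f × TangentSpace 𝓘(ℝ, ℂ) x)
    (x : S) (z₁ z₂ : TangentSpace 𝓘(ℝ, ℂ) x) : ℝ :=
  wedge (fun v w ↦ Ω (f x) v w) (fun v w ↦ Ω (f x) v w)
    (evDifferential f x (l₁ x)) (evDifferential f x (l₂ x))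
    (evDifferential f x (0, z₁)) (evDifferential f x (0, z₂))

/-- The lifting of `τ` that is zero along the surface. -/
def zeroLifting {f : C^∞⟮𝓘(ℝ, ℂ), S; 𝓘(ℝ, E), M⟯} (τ : MapTangent f) (x : S) :
    MapTangent f × TangentSpace 𝓘(ℝ, ℂ) x := (τ, 0)

/-- The two-form on the space of smooth maps, and by restriction on the space of immersed symplectic
surfaces: `(τ₁, τ₂) ↦ ∫_{{f} × S} ι_{ℓ₁ ∧ ℓ₂} ev^*(Ω ∧ Ω)`, computed with the liftings that are zero
along the surface. -/
def mapForm [IsManifold 𝓘(ℂ) ω S] [T2Space S] [CompactSpace S]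
    (Ω : BilinearField E M) (f : C^∞⟮𝓘(ℝ, ℂ), S; 𝓘(ℝ, E), M⟯) (τ₁ τ₂ : MapTangent f) : ℝ :=
  surfaceIntegral (fiberForm Ω f (zeroLifting τ₁) (zeroLifting τ₂))

/-- Any liftings may be used to compute `mapForm`. -/
theorem mapForm_eq_of_isLifting [IsManifold 𝓘(ℂ) ω S] [T2Space S] [CompactSpace S]
    {Ω : BilinearField E M} (hΩ : ∀ (x : M) (v : TangentSpace 𝓘(ℝ, E) x), Ω x v v = 0)
    {f : C^∞⟮𝓘(ℝ, ℂ), S; 𝓘(ℝ, E), M⟯} {τ₁ τ₂ : MapTangent f}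
    {l₁ l₂ : ∀ x : S, MapTangent f × TangentSpace 𝓘(ℝ, ℂ) x}
    (h₁ : IsLifting τ₁ l₁) (h₂ : IsLifting τ₂ l₂) :
    mapForm Ω f τ₁ τ₂ = surfaceIntegral (fiberForm Ω f l₁ l₂) := by
  unfold mapForm
  congr 1
  funext x z₁ z₂
  have key := wedge_add_map (V := E)
    ((ContinuousLinearMap.coeLM ℝ).comp (Ω (f x) : E →L[ℝ] E →L[ℝ] ℝ).toLinearMap)
    (fun v ↦ hΩ (f x) v) (mfderiv 𝓘(ℝ, ℂ) 𝓘(ℝ, E) f x : ℂ →L[ℝ] E).toLinearMap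
    (τ₁.val x) (τ₂.val x)
  have e : ∀ (τ : MapTangent f) (v : TangentSpace 𝓘(ℝ, ℂ) x), evDifferential f x (τ, v)
      = τ.val x + mfderiv 𝓘(ℝ, ℂ) 𝓘(ℝ, E) f x v := fun _ _ ↦ rfl
  have e' : ∀ v : TangentSpace 𝓘(ℝ, ℂ) x, evDifferential f x ((0 : MapTangent f), v)
      = mfderiv 𝓘(ℝ, ℂ) 𝓘(ℝ, E) f x v := fun v ↦ zero_add _
  have e1 : l₁ x = (τ₁, (l₁ x).2) := Prod.ext (h₁ x) rfl
  have e2 : l₂ x = (τ₂, (l₂ x).2) := Prod.ext (h₂ x) rfl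
  unfold fiberForm zeroLifting
  rw [e1, e2, e' z₁, e' z₂, e, e, e, e]
  exact (key 0 0 z₁ z₂).trans (key (l₁ x).2 (l₂ x).2 z₁ z₂).symm

/-- Compatibility at `f` of `K`, an operator on the vector fields along `f`, with a two-form `B`.
As the two-form on maps vanishes on the fields everywhere tangent to `f(S)` (the directions of
reparametrization), positivity is required modulo these: `K² = -1`, `K` maps everywhere tangent
fields to everywhere tangent fields, `K` preserves `B`, and `B(τ, K τ) > 0` for every `τ` which is
not everywhere tangent. -/
structure IsCompatibleAt (f : C^∞⟮𝓘(ℝ, ℂ), S; 𝓘(ℝ, E), M⟯)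
    (B : MapTangent f → MapTangent f → ℝ) (K : MapTangent f → MapTangent f) : Prop where
  sq : ∀ τ, K (K τ) = -τ
  map_tangent : ∀ τ, EverywhereTangent τ → EverywhereTangent (K τ)
  preserves : ∀ τ₁ τ₂, B (K τ₁) (K τ₂) = B τ₁ τ₂
  pos : ∀ τ, ¬ EverywhereTangent τ → 0 < B τ (K τ)

end MappingSpace

end SymplecticCurves

end

open SymplecticCurves

/-! The statement reduces to linear algebra at each point. In a holomorphic chart `s + i t`, put `e
= df(∂_s)`. Holomorphy of `f` gives `df(∂_t) = J e`, so the integrand of `ω(τ, J̃ τ)` is `(Ω ∧ Ω)(τ,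
J τ, e, J e)`. Let `u` be the component of `τ` that is `Ω`-orthogonal to the plane spanned by `e`
and `J e`. Subtracting vectors of this plane from `τ` and `J τ` changes nothing, and the mixed terms
vanish, leaving `2 Ω(u, J u) Ω(e, J e)` (`exists_wedge_eq`). Tameness makes this nonnegative, and
positive exactly where `τ` is not tangent to the surface.

A continuous nonnegative two-form that is positive at one point has positive integral
(`surfaceIntegral_pos`), which gives positivity. In the compatible case `J̃` preserves the integrand
itself (`wedge_map_map`), hence the integral. -/

namespace SymplecticCurves

/-! ### Positivity of the integral of a nonnegative two-form -/

section Integral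

variable {S : Type*} [TopologicalSpace S] [ChartedSpace ℂ S] [IsManifold 𝓘(ℂ) ω S]
  [T2Space S] [CompactSpace S]

/-- The integrand of `surfaceIntegral` in the chart at `c`, extended by zero to the plane. -/
noncomputable def cutoffCoeff
    (η : ∀ x : S, TangentSpace 𝓘(ℝ, ℂ) x → TangentSpace 𝓘(ℝ, ℂ) x → ℝ) (c : S) : ℂ → ℝ :=
  (chartAt ℂ c).target.indicator
    (fun z ↦ chartPartition S c ((chartAt ℂ c).symm z) * chartCoeff η c z)

variable {η : ∀ x : S, TangentSpace 𝓘(ℝ, ℂ) x → TangentSpace 𝓘(ℝ, ℂ) x → ℝ} {c : S}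

theorem surfaceIntegral_eq_finsum_cutoffCoeff :
    surfaceIntegral η = ∑ᶠ c : S, ∫ z, cutoffCoeff η c z := by
  unfold surfaceIntegral cutoffCoeff
  exact finsum_congr fun c ↦ (integral_indicator (chartAt ℂ c).open_target.measurableSet).symm

variable (c) in
theorem isCompact_chartAt_image_tsupport :
    IsCompact (chartAt ℂ c '' tsupport (chartPartition S c)) :=
  (isClosed_tsupport _).isCompact.image_of_continuousOn
    ((chartAt ℂ c).continuousOn.mono (chartPartition_isSubordinate c))

theorem cutoffCoeff_eq_zero {z : ℂ}
    (hz : z ∉ chartAt ℂ c '' tsupport (chartPartition S c)) : cutoffCoeff η c z = 0 := by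
  by_cases h : z ∈ (chartAt ℂ c).target
  · rw [cutoffCoeff, indicator_of_mem h]
    have : (chartAt ℂ c).symm z ∉ tsupport (chartPartition S c) := fun h' ↦
      hz ⟨_, h', (chartAt ℂ c).right_inv h⟩
    rw [image_eq_zero_of_notMem_tsupport this, zero_mul]
  · exact indicator_of_notMem h _

theorem hasCompactSupport_cutoffCoeff : HasCompactSupport (cutoffCoeff η c) :=
  .intro (isCompact_chartAt_image_tsupport c) fun _ ↦ cutoffCoeff_eq_zero

/-- Extension by zero creates no jump at the boundary of the chart: the function vanishes off a
compact subset of the target, whose complement is an open neighbourhood of every point outside the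
target. -/
theorem continuous_cutoffCoeff (h : ContinuousOn (chartCoeff η c) (chartAt ℂ c).target) :
    Continuous (cutoffCoeff η c) := by
  refine continuous_iff_continuousAt.2 fun z ↦ ?_
  by_cases hz : z ∈ (chartAt ℂ c).target
  · have h1 : ContinuousOn (fun z ↦ chartPartition S c ((chartAt ℂ c).symm z) * chartCoeff η c z)
        (chartAt ℂ c).target :=
      ((chartPartition S c).contMDiff.continuous.comp_continuousOn (chartAt ℂ c).continuousOn_symm).mul h
    have hn := (chartAt ℂ c).open_target.mem_nhds hz
    refine (h1.continuousAt hn).congr ?_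
    filter_upwards [hn] with w hw
    rw [cutoffCoeff, indicator_of_mem hw]
  · have hK : z ∉ chartAt ℂ c '' tsupport (chartPartition S c) := by
      rintro ⟨x, hx, rfl⟩
      exact hz ((chartAt ℂ c).map_source (chartPartition_isSubordinate c hx))
    refine (continuousAt_const (y := (0 : ℝ))).congr ?_
    filter_upwards [(isCompact_chartAt_image_tsupport c).isClosed.isOpen_compl.mem_nhds hK]
      with w hw
    exact (cutoffCoeff_eq_zero hw).symm

theorem cutoffCoeff_nonneg (h : ∀ z ∈ (chartAt ℂ c).target, 0 ≤ chartCoeff η c z) :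
    0 ≤ cutoffCoeff η c :=
  indicator_nonneg fun z hz ↦ mul_nonneg ((chartPartition S).nonneg _ _) (h z hz)

/-- The integral of a continuous nonnegative two-form which is positive at a point is positive. -/
theorem surfaceIntegral_pos
    (hcont : ∀ c, ContinuousOn (chartCoeff η c) (chartAt ℂ c).target)
    (hnonneg : ∀ c, ∀ z ∈ (chartAt ℂ c).target, 0 ≤ chartCoeff η c z) {x : S}
    (hpos : ∀ c, x ∈ (chartAt ℂ c).source → 0 < chartCoeff η c (chartAt ℂ c x)) :
    0 < surfaceIntegral η := by
  rw [surfaceIntegral_eq_finsum_cutoffCoeff]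
  refine finsum_pos (fun c ↦ integral_nonneg (cutoffCoeff_nonneg (hnonneg c))) ?_ ?_
  -- Some partition function is positive at `x`, and its chart contributes a positive integral.
  · obtain ⟨c, hc⟩ := (chartPartition S).exists_pos_of_mem (mem_univ x)
    have hx : x ∈ (chartAt ℂ c).source :=
      chartPartition_isSubordinate c (subset_tsupport _ hc.ne')
    refine ⟨c, (continuous_cutoffCoeff (hcont c)).integral_pos_of_hasCompactSupport_nonneg_nonzero
      hasCompactSupport_cutoffCoeff (cutoffCoeff_nonneg (hnonneg c)) (x := chartAt ℂ c x) ?_⟩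
    rw [cutoffCoeff, indicator_of_mem ((chartAt ℂ c).map_source hx), (chartAt ℂ c).left_inv hx]
    exact (mul_pos hc (hpos c hx)).ne'
  -- A `finsum` with infinite support is zero by convention, so finiteness is needed: by compactness
  -- only finitely many partition functions are not identically zero.
  · refine (chartPartition S).locallyFinite.finite_nonempty_of_compact.subset fun c hc ↦ ?_
    by_contra hne
    have h0 : ∀ y, chartPartition S c y = 0 := by
      simpa [Function.support_eq_empty_iff, not_nonempty_iff_eq_empty, funext_iff] using hne
    exact hc (by simp [cutoffCoeff, h0])

end Integral

/-! ### The complex structure in a holomorphic chart -/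

/-- Transition maps between holomorphic charts have complex linear derivatives, so multiplication by
`i` does not depend on the chart in which it is read. -/
theorem mfderiv_chartAt_symm_I {S : Type*} [TopologicalSpace S] [ChartedSpace ℂ S]
    [IsManifold 𝓘(ℂ) ω S] (c : S) {z : ℂ} (hz : z ∈ (chartAt ℂ c).target) :
    mfderiv 𝓘(ℝ, ℂ) 𝓘(ℝ, ℂ) (chartAt ℂ c).symm z Complex.I
      = complexStructure ((chartAt ℂ c).symm z)
        (mfderiv 𝓘(ℝ, ℂ) 𝓘(ℝ, ℂ) (chartAt ℂ c).symm z (1 : ℂ)) := by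
  have hd : MDifferentiableAt 𝓘(ℝ, ℂ) 𝓘(ℝ, ℂ) (chartAt ℂ c).symm z :=
    mdifferentiableAt_atlas_symm (chart_mem_atlas ℂ c) hz
  set x := (chartAt ℂ c).symm z with hx
  have h := (contDiffGroupoid ω 𝓘(ℂ)).compatible (chart_mem_atlas ℂ c) (chart_mem_atlas ℂ x)
  rw [contDiffGroupoid, mem_groupoid_of_pregroupoid] at h
  have h1 : ContDiffOn ℂ ω (𝓘(ℂ) ∘ ((chartAt ℂ c).symm ≫ₕ chartAt ℂ x) ∘ 𝓘(ℂ).symm)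
    (𝓘(ℂ).symm ⁻¹' ((chartAt ℂ c).symm ≫ₕ chartAt ℂ x).source ∩ range 𝓘(ℂ)) := h.1
  have h2 : DifferentiableAt ℂ (chartAt ℂ x ∘ (chartAt ℂ c).symm) z := by
    have h3 : DifferentiableOn ℂ (chartAt ℂ x ∘ (chartAt ℂ c).symm)
        ((chartAt ℂ c).symm ≫ₕ chartAt ℂ x).source := by
      simpa using h1.differentiableOn (by simp)
    refine h3.differentiableAt (((chartAt ℂ c).symm ≫ₕ chartAt ℂ x).open_source.mem_nhds ?_)
    simp [hz, ← hx]
  -- `mfderiv` is read in the preferred chart at the image point `x`, so it is the real derivative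
  -- of a transition map.
  have h4 : mfderiv 𝓘(ℝ, ℂ) 𝓘(ℝ, ℂ) (chartAt ℂ c).symm z
      = (fderiv ℂ (chartAt ℂ x ∘ (chartAt ℂ c).symm) z).restrictScalars ℝ := by
    have h5 := h2.fderiv_restrictScalars ℝ
    rw [← h5]
    simp [mfderiv, hd, writtenInExtChartAt, extChartAt, ← hx]
    rfl
  rw [h4]
  change fderiv ℂ (chartAt ℂ x ∘ (chartAt ℂ c).symm) z Complex.I
    = Complex.I * fderiv ℂ (chartAt ℂ x ∘ (chartAt ℂ c).symm) z (1 : ℂ)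
  rw [← smul_eq_mul, ← map_smul, smul_eq_mul, mul_one]

/-! ### Linear algebra of `Ω ∧ Ω` on complex planes -/

section LinearAlgebra

variable {V : Type*} [AddCommGroup V] [Module ℝ V] {B : V →ₗ[ℝ] V →ₗ[ℝ] ℝ} {J : V →ₗ[ℝ] V}

theorem skew_of_alternating (hB : ∀ v, B v v = 0) (x y : V) : B x y = -B y x := by
  have h := hB (x + y)
  simp only [map_add, LinearMap.add_apply, hB] at h
  linarith

/-- With `u = v - (a e + b J e)`, both `v - u` and `J v - J u` lie in the plane of `e` and `J e`, so
`v` may be replaced by `u`. If `u` is `B`-orthogonal to that plane, only the product `B(u, J u) B(e,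
J e)` survives, twice. -/
theorem exists_wedge_eq (hB : ∀ v, B v v = 0) (hJ : ∀ v, J (J v) = -v) {e : V}
    (he : 0 < B e (J e)) (v : V) :
    ∃ a b : ℝ, wedge (fun v w ↦ B v w) (fun v w ↦ B v w) v (J v) e (J e)
      = 2 * (B (v - (a • e + b • J e)) (J (v - (a • e + b • J e))) * B e (J e)) := by
  -- These coefficients solve `B(u, J e) = 0` and `B(u, e) = 0`.
  refine ⟨B v (J e) / B e (J e), -(B v e / B e (J e)), ?_⟩
  set a := B v (J e) / B e (J e) with ha
  set b := -(B v e / B e (J e)) with hb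
  have ha' : B v (J e) = a * B e (J e) := by rw [ha]; field_simp
  have hb' : B v e = -(b * B e (J e)) := by rw [hb]; field_simp
  simp only [wedge, map_sub, map_add, map_smul, hJ, LinearMap.sub_apply, LinearMap.add_apply,
    LinearMap.smul_apply, smul_eq_mul, map_neg, hB]
  rw [skew_of_alternating hB (J e) (J v), skew_of_alternating hB e (J v),
    skew_of_alternating hB (J e) e, ha', hb']
  ring

theorem wedge_nonneg_of_tamed (hB : ∀ v, B v v = 0) (hJ : ∀ v, J (J v) = -v)
    (hBJ : ∀ v, v ≠ 0 → 0 < B v (J v)) {e : V} (he : e ≠ 0) (v : V) :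
    0 ≤ wedge (fun v w ↦ B v w) (fun v w ↦ B v w) v (J v) e (J e) := by
  obtain ⟨a, b, h⟩ := exists_wedge_eq hB hJ (hBJ e he) v
  rw [h]
  have h1 : 0 ≤ B (v - (a • e + b • J e)) (J (v - (a • e + b • J e))) := by
    by_cases h0 : v - (a • e + b • J e) = 0
    · simp [h0]
    · exact (hBJ _ h0).le
  have := hBJ e he
  positivity

theorem wedge_pos_of_tamed (hB : ∀ v, B v v = 0) (hJ : ∀ v, J (J v) = -v)
    (hBJ : ∀ v, v ≠ 0 → 0 < B v (J v)) {e : V} (he : e ≠ 0) {v : V}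
    (hv : ∀ a b : ℝ, v ≠ a • e + b • J e) :
    0 < wedge (fun v w ↦ B v w) (fun v w ↦ B v w) v (J v) e (J e) := by
  obtain ⟨a, b, h⟩ := exists_wedge_eq hB hJ (hBJ e he) v
  rw [h]
  have := hBJ e he
  have := hBJ _ (sub_ne_zero.2 (hv a b))
  positivity

/-- Invariance gives `B(J u, e) = -B(u, J e)` and `B(J u, J e) = B(u, e)`, so applying `J` to `v`
and `w` merely interchanges the mixed products. -/
theorem wedge_map_map (hJ : ∀ v, J (J v) = -v) (hBJ : ∀ v w, B (J v) (J w) = B v w) (v w e : V) :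
    wedge (fun v w ↦ B v w) (fun v w ↦ B v w) (J v) (J w) e (J e)
      = wedge (fun v w ↦ B v w) (fun v w ↦ B v w) v w e (J e) := by
  have h : ∀ u, B (J u) e = -B u (J e) := fun u ↦ by
    have := hBJ u (J e)
    rw [hJ, map_neg] at this
    linarith
  simp only [wedge, hBJ, h]
  ring

end LinearAlgebra

/-! ### The two-form on the space of maps -/

section MappingSpace

variable {E : Type*} [NormedAddCommGroup E] [NormedSpace ℝ E]
  {M : Type*} [TopologicalSpace M] [ChartedSpace E M] [IsManifold 𝓘(ℝ, E) ∞ M]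
  {S : Type*} [TopologicalSpace S] [ChartedSpace ℂ S]

/-- The image under `df_x` of the vector with coordinates `ζ` in the chart at `c`, where `x` is the
point with coordinate `z` in that chart. -/
noncomputable def chartVector (f : C^∞⟮𝓘(ℝ, ℂ), S; 𝓘(ℝ, E), M⟯) (c : S) (z ζ : ℂ) :
    TangentSpace 𝓘(ℝ, E) (f ((chartAt ℂ c).symm z)) :=
  mfderiv 𝓘(ℝ, ℂ) 𝓘(ℝ, E) f ((chartAt ℂ c).symm z)
    (mfderiv 𝓘(ℝ, ℂ) 𝓘(ℝ, ℂ) (chartAt ℂ c).symm z ζ)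

theorem chartCoeff_fiberForm (Ω : BilinearField E M) (f : C^∞⟮𝓘(ℝ, ℂ), S; 𝓘(ℝ, E), M⟯)
    (τ₁ τ₂ : MapTangent f) (c : S) (z : ℂ) :
    chartCoeff (fiberForm Ω f (zeroLifting τ₁) (zeroLifting τ₂)) c z
      = wedge (fun v w ↦ Ω (f ((chartAt ℂ c).symm z)) v w)
        (fun v w ↦ Ω (f ((chartAt ℂ c).symm z)) v w)
        (τ₁.val ((chartAt ℂ c).symm z)) (τ₂.val ((chartAt ℂ c).symm z))
        (chartVector f c z 1) (chartVector f c z Complex.I) := by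
  have e (x : S) (τ : MapTangent f) : evDifferential f x (τ, 0) = τ.val x := by
    unfold evDifferential
    rw [map_zero, add_zero]
  have e' (x : S) (v : TangentSpace 𝓘(ℝ, ℂ) x) : evDifferential f x ((0 : MapTangent f), v)
      = mfderiv 𝓘(ℝ, ℂ) 𝓘(ℝ, E) f x v := zero_add _
  unfold chartCoeff fiberForm zeroLifting
  rw [e, e, e', e']
  rfl

/-! ### Continuity of the integrand in a chart -/

variable [IsManifold 𝓘(ℂ) ω S]

/-- This field is the tangent map of `f ∘ φ⁻¹`, with `φ` the chart at `c`, applied to the constant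
field `ζ`. -/
theorem contMDiffOn_chartVector (f : C^∞⟮𝓘(ℝ, ℂ), S; 𝓘(ℝ, E), M⟯) (c : S) (ζ : ℂ) :
    ContMDiffOn 𝓘(ℝ, ℂ) (𝓘(ℝ, E).prod 𝓘(ℝ, E)) ∞
      (fun z ↦ (TotalSpace.mk' E (f ((chartAt ℂ c).symm z)) (chartVector f c z ζ) :
        TangentBundle 𝓘(ℝ, E) M)) (chartAt ℂ c).target := by
  have hs : ContMDiffOn 𝓘(ℝ, ℂ) 𝓘(ℝ, ℂ) ∞ (chartAt ℂ c).symm (chartAt ℂ c).target :=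
    contMDiffOn_chart_symm
  have hg : ContMDiffOn 𝓘(ℝ, ℂ) 𝓘(ℝ, E) ∞ (f ∘ (chartAt ℂ c).symm) (chartAt ℂ c).target :=
    f.contMDiff.comp_contMDiffOn hs
  have hu : UniqueMDiffOn 𝓘(ℝ, ℂ) (chartAt ℂ c).target := (chartAt ℂ c).open_target.uniqueMDiffOn
  have ht := hg.contMDiffOn_tangentMapWithin (m := ∞) le_rfl hu
  have hc : ContMDiff 𝓘(ℝ, ℂ) (𝓘(ℝ, ℂ).prod 𝓘(ℝ, ℂ)) ∞
      (fun z : ℂ ↦ (TotalSpace.mk' ℂ z ζ : TangentBundle 𝓘(ℝ, ℂ) ℂ)) := by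
    intro z
    rw [contMDiffAt_totalSpace]
    refine ⟨contMDiffAt_id, ?_⟩
    simpa using contMDiffAt_const
  refine (ht.comp hc.contMDiffOn (fun z hz ↦ hz)).congr fun z hz ↦ ?_
  simp only [Function.comp_apply, tangentMapWithin]
  rw [mfderivWithin_of_isOpen (chartAt ℂ c).open_target hz, mfderiv_comp (I' := 𝓘(ℝ, ℂ)) z
    (f.contMDiff.mdifferentiable (by simp) _)
    (mdifferentiableAt_atlas_symm (chart_mem_atlas ℂ c) hz)]
  rfl

theorem contMDiffOn_val_chartAt_symm {f : C^∞⟮𝓘(ℝ, ℂ), S; 𝓘(ℝ, E), M⟯} (τ : MapTangent f)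
    (c : S) :
    ContMDiffOn 𝓘(ℝ, ℂ) (𝓘(ℝ, E).prod 𝓘(ℝ, E)) ∞
      (fun z ↦ (TotalSpace.mk' E (f ((chartAt ℂ c).symm z)) (τ.val ((chartAt ℂ c).symm z)) :
        TangentBundle 𝓘(ℝ, E) M)) (chartAt ℂ c).target :=
  ((contMDiff_along_iff f τ.val).1 τ.contMDiff).comp_contMDiffOn contMDiffOn_chart_symm

omit [IsManifold 𝓘(ℂ) ω S] [TopologicalSpace S] [ChartedSpace ℂ S] in
theorem IsSymplecticForm.continuousOn_apply {Ω : BilinearField E M} (hΩ : IsSymplecticForm Ω)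
    {g : ℂ → M} {s : Set ℂ} {v w : ∀ z, TangentSpace 𝓘(ℝ, E) (g z)}
    (hg : ContMDiffOn 𝓘(ℝ, ℂ) 𝓘(ℝ, E) ∞ g s)
    (hv : ContMDiffOn 𝓘(ℝ, ℂ) (𝓘(ℝ, E).prod 𝓘(ℝ, E)) ∞
      (fun z ↦ (TotalSpace.mk' E (g z) (v z) : TangentBundle 𝓘(ℝ, E) M)) s)
    (hw : ContMDiffOn 𝓘(ℝ, ℂ) (𝓘(ℝ, E).prod 𝓘(ℝ, E)) ∞
      (fun z ↦ (TotalSpace.mk' E (g z) (w z) : TangentBundle 𝓘(ℝ, E) M)) s) :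
    ContinuousOn (fun z ↦ Ω (g z) (v z) (w z)) s := by
  -- The scalar is viewed as a section of the trivial line bundle, so that contraction of smooth
  -- bundle sections applies.
  have h : ContMDiffOn 𝓘(ℝ, ℂ) (𝓘(ℝ, E).prod 𝓘(ℝ)) ∞
      (fun z ↦ TotalSpace.mk' ℝ (E := Bundle.Trivial M ℝ) (g z) (Ω (g z) (v z) (w z))) s :=
    ContMDiffOn.clm_bundle_apply₂ (F₁ := E) (F₂ := E) (hΩ.smooth.comp_contMDiffOn hg) hv hw
  intro z hz
  have h' := h z hz
  simp only [contMDiffWithinAt_totalSpace] at h'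
  exact h'.2.continuousWithinAt

theorem IsSymplecticForm.continuousOn_chartCoeff_fiberForm {Ω : BilinearField E M}
    (hΩ : IsSymplecticForm Ω) (f : C^∞⟮𝓘(ℝ, ℂ), S; 𝓘(ℝ, E), M⟯) (τ₁ τ₂ : MapTangent f) (c : S) :
    ContinuousOn (chartCoeff (fiberForm Ω f (zeroLifting τ₁) (zeroLifting τ₂)) c)
      (chartAt ℂ c).target := by
  have hg : ContMDiffOn 𝓘(ℝ, ℂ) 𝓘(ℝ, E) ∞ (fun z ↦ f ((chartAt ℂ c).symm z))
      (chartAt ℂ c).target := f.contMDiff.comp_contMDiffOn contMDiffOn_chart_symm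
  have h1 := contMDiffOn_val_chartAt_symm τ₁ c
  have h2 := contMDiffOn_val_chartAt_symm τ₂ c
  have h3 := contMDiffOn_chartVector f c 1
  have h4 := contMDiffOn_chartVector f c Complex.I
  rw [funext (chartCoeff_fiberForm Ω f τ₁ τ₂ c)]
  unfold wedge
  have a12 := hΩ.continuousOn_apply hg h1 h2
  have a13 := hΩ.continuousOn_apply hg h1 h3
  have a14 := hΩ.continuousOn_apply hg h1 h4
  have a23 := hΩ.continuousOn_apply hg h2 h3
  have a24 := hΩ.continuousOn_apply hg h2 h4
  have a34 := hΩ.continuousOn_apply hg h3 h4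
  exact (((((a12.mul a34).sub (a13.mul a24)).add (a14.mul a23)).add (a23.mul a14)).sub
    (a24.mul a13)).add (a34.mul a12)

/-! ### The integrand along a `J`-holomorphic immersion -/

theorem IsJHolomorphic.chartVector_I {J : AlmostComplexStructure E M}
    {f : C^∞⟮𝓘(ℝ, ℂ), S; 𝓘(ℝ, E), M⟯} (hJ : IsJHolomorphic J f) (c : S) {z : ℂ}
    (hz : z ∈ (chartAt ℂ c).target) :
    chartVector f c z Complex.I
      = J.toFun (f ((chartAt ℂ c).symm z)) (chartVector f c z 1) := by
  unfold chartVector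
  rw [mfderiv_chartAt_symm_I c hz, hJ]

omit [IsManifold 𝓘(ℝ, E) ∞ M] in
theorem chartVector_ne_zero {f : C^∞⟮𝓘(ℝ, ℂ), S; 𝓘(ℝ, E), M⟯}
    (hf : ∀ x : S, Function.Injective (mfderiv 𝓘(ℝ, ℂ) 𝓘(ℝ, E) f x)) (c : S) {z : ℂ}
    (hz : z ∈ (chartAt ℂ c).target) : chartVector f c z 1 ≠ 0 := by
  have h : Function.Injective (mfderiv 𝓘(ℝ, ℂ) 𝓘(ℝ, ℂ) (chartAt ℂ c).symm z) :=
    (mdifferentiable_chart c).symm.mfderiv_injective hz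
  intro h0
  exact one_ne_zero (α := ℂ) (h (hf _ (h0.trans (map_zero _).symm) |>.trans (map_zero _).symm))

/-- The form `Ω_x` as a bilinear map on the model space. -/
noncomputable def BilinearField.linearAt (Ω : BilinearField E M) (x : M) : E →ₗ[ℝ] E →ₗ[ℝ] ℝ :=
  ContinuousLinearMap.toLinearMap₁₂ (Ω x : E →L[ℝ] E →L[ℝ] ℝ)

/-- The endomorphism `J_x` as a linear map on the model space. -/
noncomputable def AlmostComplexStructure.linearAt (J : AlmostComplexStructure E M) (x : M) : E →ₗ[ℝ] E :=
  (J.toFun x : E →L[ℝ] E).toLinearMap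

variable {Ω : BilinearField E M} {J : AlmostComplexStructure E M}
  {f : C^∞⟮𝓘(ℝ, ℂ), S; 𝓘(ℝ, E), M⟯}

theorem IsJHolomorphic.chartCoeff_fiberForm_inducedJ (hJ : IsJHolomorphic J f)
    (τ : MapTangent f) (c : S) {z : ℂ} (hz : z ∈ (chartAt ℂ c).target) :
    chartCoeff (fiberForm Ω f (zeroLifting τ) (zeroLifting (inducedJ J f τ))) c z
      = wedge (V := E) (fun v w ↦ Ω.linearAt (f ((chartAt ℂ c).symm z)) v w)
        (fun v w ↦ Ω.linearAt (f ((chartAt ℂ c).symm z)) v w)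
        (τ.val ((chartAt ℂ c).symm z))
        (J.linearAt (f ((chartAt ℂ c).symm z)) (τ.val ((chartAt ℂ c).symm z)))
        (chartVector f c z 1) (J.linearAt (f ((chartAt ℂ c).symm z)) (chartVector f c z 1)) := by
  rw [chartCoeff_fiberForm, hJ.chartVector_I c hz]
  rfl

/-! ### Positivity and invariance of the two-form -/

theorem mapForm_inducedJ_pos [T2Space S] [CompactSpace S] (hΩ : IsSymplecticForm Ω)
    (hf : ∀ x : S, Function.Injective (mfderiv 𝓘(ℝ, ℂ) 𝓘(ℝ, E) f x))
    (hJ : IsJHolomorphic J f) (hJΩ : J.IsTamed Ω) {τ : MapTangent f}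
    (hτ : ¬ EverywhereTangent τ) : 0 < mapForm Ω f τ (inducedJ J f τ) := by
  unfold EverywhereTangent at hτ
  push Not at hτ
  obtain ⟨x, hx⟩ := hτ
  refine surfaceIntegral_pos (x := x) (hΩ.continuousOn_chartCoeff_fiberForm f _ _)
    (fun c z hz ↦ ?_) (fun c hc ↦ ?_)
  · rw [hJ.chartCoeff_fiberForm_inducedJ τ c hz]
    exact wedge_nonneg_of_tamed (hΩ.alternating _) (J.sq _) (hJΩ _) (chartVector_ne_zero hf c hz) _
  · have hz := (chartAt ℂ c).map_source hc
    rw [hJ.chartCoeff_fiberForm_inducedJ τ c hz]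
    refine wedge_pos_of_tamed (hΩ.alternating _) (J.sq _) (hJΩ _) (chartVector_ne_zero hf c hz)
      fun a b hab ↦ ?_
    -- A combination of `e` and `J e = df(∂_t)` is the image under `df` of a tangent vector of the
    -- surface, contrary to the choice of `x`.
    have h1 : τ.val ((chartAt ℂ c).symm (chartAt ℂ c x))
        = a • chartVector f c (chartAt ℂ c x) 1
          + b • chartVector f c (chartAt ℂ c x) Complex.I := by
      rw [hJ.chartVector_I c hz]
      exact hab
    have h2 : τ.val ((chartAt ℂ c).symm (chartAt ℂ c x))
        ∈ range (mfderiv 𝓘(ℝ, ℂ) 𝓘(ℝ, E) f ((chartAt ℂ c).symm (chartAt ℂ c x))) := by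
      rw [h1]
      unfold chartVector
      rw [← map_smul, ← map_smul, ← map_add]
      exact mem_range_self _
    rw [(chartAt ℂ c).left_inv hc] at h2
    exact hx h2

theorem mapForm_inducedJ_inducedJ [T2Space S] [CompactSpace S]
    (hJ : IsJHolomorphic J f)
    (hJΩ : ∀ (x : M) (v w : TangentSpace 𝓘(ℝ, E) x), Ω x (J.toFun x v) (J.toFun x w) = Ω x v w)
    (τ₁ τ₂ : MapTangent f) :
    mapForm Ω f (inducedJ J f τ₁) (inducedJ J f τ₂) = mapForm Ω f τ₁ τ₂ := by
  refine finsum_congr fun c ↦ setIntegral_congr_fun (chartAt ℂ c).open_target.measurableSet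
    fun z hz ↦ ?_
  refine congrArg (chartPartition S c ((chartAt ℂ c).symm z) * ·) ?_
  rw [chartCoeff_fiberForm, chartCoeff_fiberForm, hJ.chartVector_I c hz]
  exact wedge_map_map (V := E) (B := Ω.linearAt (f ((chartAt ℂ c).symm z)))
    (J := J.linearAt (f ((chartAt ℂ c).symm z))) (J.sq _) (hJΩ _) _ _ _

omit [IsManifold 𝓘(ℂ) ω S] in
theorem IsJHolomorphic.everywhereTangent_inducedJ (hJ : IsJHolomorphic J f) {τ : MapTangent f}
    (hτ : EverywhereTangent τ) : EverywhereTangent (inducedJ J f τ) := fun x ↦ by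
  obtain ⟨v, hv⟩ := hτ x
  refine ⟨complexStructure x v, ?_⟩
  rw [hJ, hv]
  rfl

omit [IsManifold 𝓘(ℂ) ω S] in
theorem inducedJ_inducedJ (τ : MapTangent f) : inducedJ J f (inducedJ J f τ) = -τ :=
  ContMDiffSection.ext fun x ↦ J.sq (f x) (τ.val x)

end MappingSpace

end SymplecticCurves
theorem mainTheorem5
    {E : Type*} [NormedAddCommGroup E] [NormedSpace ℝ E] [FiniteDimensional ℝ E]
    {M : Type*} [TopologicalSpace M] [ChartedSpace E M] [IsManifold 𝓘(ℝ, E) ∞ M]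
    {S : Type*} [TopologicalSpace S] [ChartedSpace ℂ S] [IsManifold 𝓘(ℂ) ω S]
    [T2Space S] [CompactSpace S]
    (Ω : BilinearField E M) (hΩ : IsSymplecticForm Ω) (J : AlmostComplexStructure E M)
    (f : C^∞⟮𝓘(ℝ, ℂ), S; 𝓘(ℝ, E), M⟯) (hf : f ∈ immersedSymplectic Ω)
    (hJ : IsJHolomorphic J f) :
    (J.IsTamed Ω →
      ∀ τ : MapTangent f, ¬ EverywhereTangent τ → 0 < mapForm Ω f τ (inducedJ J f τ)) ∧
    (J.IsCompatible Ω → IsCompatibleAt f (mapForm Ω f) (inducedJ J f)) :=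
  ⟨fun h _ hτ ↦ mapForm_inducedJ_pos hΩ hf.1 hJ h hτ, fun h ↦
    { sq := inducedJ_inducedJ
      map_tangent := fun _ ↦ hJ.everywhereTangent_inducedJ
      preserves := mapForm_inducedJ_inducedJ hJ h.2
      pos := fun _ ↦ mapForm_inducedJ_pos hΩ hf.1 hJ h.1 }⟩
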